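/- Let $\tau$ be the substitution on finite words over $\{0,1\}$ given by $1\mapsto 101$, $0\mapsto 1$, and let $\mathbf{s}=(s_j)_{j\ge 0}=\lim_{n\to\infty}\tau^n(1)$ be its fixed point beginning with $1$, regarded as an integer sequence. For $m\ge 0$ and $n\ge 1$ let $H_{m,n}=\det\,(s_{m+i+j})_{0\le i,j\le n-1}$ be the Hankel determinants of $\mathbf{s}$. For $j\ge 0$ put $f_{2j}=|\tau^j(1)|$ and $f_{2j+1}=|\tau^j(10)|$, where $|w|$ denotes the length of the word $w$. Then for every $k\ge 1$ the integer $f_{2k+1}$ is even and \[ H_{\frac{f_{2k+1}}{2}+1,\; f_{2k+3}-1}=(-1)^{k+1}\,\frac{f_{2k+1}}{2}. \] -/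

import Mathlib

namespace HankelTau

/-- The image of a letter under the substitution `1 ↦ 101`, `0 ↦ 1`.
The letter `1` is `true` and the letter `0` is `false`. -/
def tauLetter : Bool → List Bool
  | true => [true, false, true]
  | false => [true]

/-- The substitution on finite words (a morphism for concatenation). -/
def tau (w : List Bool) : List Bool := w.flatMap tauLetter

/-- The word `τⁿ(w)`. -/
def tauIter (n : ℕ) (w : List Bool) : List Bool := tau^[n] w

theorem tau_append (u v : List Bool) : tau (u ++ v) = tau u ++ tau v := by
  simp [tau]

theorem tauIter_succ (n : ℕ) (w : List Bool) : tauIter (n + 1) w = tau (tauIter n w) :=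
  Function.iterate_succ_apply' tau n w

theorem tauIter_prefix_succ (n : ℕ) : tauIter n [true] <+: tauIter (n + 1) [true] := by
  induction n with
  | zero => exact ⟨[false, true], rfl⟩
  | succ n ih =>
    obtain ⟨t, ht⟩ := ih
    refine ⟨tau t, ?_⟩
    rw [tauIter_succ (n + 1), tauIter_succ n, ← tau_append, ht, tauIter_succ n]

theorem tauIter_prefix {m n : ℕ} (h : m ≤ n) : tauIter m [true] <+: tauIter n [true] := by
  induction n, h using Nat.le_induction with
  | base => exact List.prefix_refl _
  | succ n _ ih => exact ih.trans (tauIter_prefix_succ n)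

theorem length_le_length_tau (w : List Bool) : w.length ≤ (tau w).length := by
  induction w with
  | nil => simp
  | cons a w ih =>
    have h : tau (a :: w) = tauLetter a ++ tau w := by simp [tau]
    rw [h, List.length_append, List.length_cons]
    cases a <;> simp [tauLetter] <;> omega

theorem lt_length_tauIter (n : ℕ) : n < (tauIter n [true]).length := by
  induction n with
  | zero => simp [tauIter]
  | succ n ih =>
    obtain ⟨t, ht⟩ := tauIter_prefix (Nat.zero_le n)
    have ht' : tauIter n [true] = true :: t := by simpa [tauIter] using ht.symm
    have h : tau (true :: t) = [true, false, true] ++ tau t := by simp [tau, tauLetter]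
    have hl := length_le_length_tau t
    rw [ht', List.length_cons] at ih
    rw [tauIter_succ, ht', h, List.length_append]
    simp only [List.length_cons, List.length_nil]
    omega

/-- The `j`-th letter of the infinite word `lim τⁿ(1)`: the words `τⁿ(1)` are prefixes of one
another, and `τʲ(1)` is long enough to have a letter with index `j`. -/
def sLetter (j : ℕ) : Bool := (tauIter j [true])[j]'(lt_length_tauIter j)

/-- Every `τⁿ(1)` is a prefix of the infinite word. -/
theorem getElem_tauIter (n j : ℕ) (h : j < (tauIter n [true]).length) :
    (tauIter n [true])[j] = sLetter j := by
  rcases le_total n j with hnj | hjn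
  · exact (tauIter_prefix hnj).getElem h
  · exact ((tauIter_prefix hjn).getElem (lt_length_tauIter j)).symm

/-- The integer sequence `(s_j)` with values in `{0, 1}`. -/
def s (j : ℕ) : ℤ := if sLetter j then 1 else 0

/-- `f_{2j} = |τʲ(1)|` and `f_{2j+1} = |τʲ(10)|`. -/
def f (n : ℕ) : ℕ :=
  if Even n then (tauIter (n / 2) [true]).length else (tauIter (n / 2) [true, false]).length

/-- The Hankel matrix `(u_{m+i+j})`, `0 ≤ i, j ≤ n - 1`, of an integer sequence. -/
def hankelMatrix (u : ℕ → ℤ) (m n : ℕ) : Matrix (Fin n) (Fin n) ℤ :=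
  Matrix.of fun i j => u (m + i + j)

/-- The Hankel determinant `H_{m,n}` of the sequence `s`. -/
def H (m n : ℕ) : ℤ := (hankelMatrix s m n).det

end HankelTau

/-! Let N(j) be the integer nearest to j/√2. The differences N(j+1) − N(j) satisfy the
self-similarity of `tau` (`tau_stepPrefix`), so they are the letters of the fixed point.

Let P/Q be the convergent of √2 with 2Q = f_{2k+3} and P² − 2Q² = e = ±1; then P − Q = f_{2k+1}/2.
For j < P + 3Q, N(j) = ⌊(Pj + b)/(2Q)⌋ with b = Q or Q − 1 (`onesCount_eq_div`). The range covers
every entry of the Hankel matrix, which therefore codes the rotation by P modulo 2Q and is a maximal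
minor of a 2Q × 2Q periodic Hankel matrix C.

Since d = eP inverts P modulo 2Q, rows i and i + d of C differ in two adjacent entries only.
Multiplying C by (shift by d) − 1 + (all ones) yields a matrix of the same kind up to a reflection,
whence det C = −P. An explicit solution of C h = P·e₋₁ and Cramer's rule then give the minor −h(−1)
= e(Q − P) (`det_periodic_hankel`, `H_convergent`). -/

namespace HankelTau

/-! ### The fixed point as increments of the integer nearest to j/√2. -/

/-- The number of ones among the first `j` letters: the integer nearest to `j / √2`. -/
def onesCount (j : ℕ) : ℕ := (Nat.sqrt (2 * j ^ 2) + 1) / 2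

theorem le_onesCount_iff (r j : ℕ) : r + 1 ≤ onesCount j ↔ (2 * r + 1) ^ 2 ≤ 2 * j ^ 2 := by
  rw [← Nat.le_sqrt', onesCount]
  omega

theorem onesCount_lt_iff (r j : ℕ) : onesCount j ≤ r ↔ 2 * j ^ 2 < (2 * r + 1) ^ 2 := by
  rw [← not_iff_not, not_le, not_lt, ← le_onesCount_iff, Nat.succ_le_iff]

theorem onesCount_zero : onesCount 0 = 0 := by simp [onesCount]

theorem two_mul_sq_ne_sq_odd (j r : ℕ) : 2 * j ^ 2 ≠ (2 * r + 1) ^ 2 := by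
  intro h
  have : (2 * r + 1) ^ 2 = 2 * (2 * r ^ 2 + 2 * r) + 1 := by ring
  omega

theorem onesCount_succ_le (j : ℕ) : onesCount (j + 1) ≤ onesCount j + 1 := by
  rw [onesCount_lt_iff]
  have h := (onesCount_lt_iff (onesCount j) j).1 le_rfl
  have h2 : j ≤ 2 * onesCount j := by
    by_contra! h3
    have : (2 * onesCount j + 1) ^ 2 ≤ j ^ 2 := Nat.pow_le_pow_left h3 2
    omega
  nlinarith

theorem onesCount_mono (j : ℕ) : onesCount j ≤ onesCount (j + 1) := by
  rw [onesCount_lt_iff]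
  have h := (onesCount_lt_iff (onesCount (j + 1)) (j + 1)).1 le_rfl
  have h2 : j ^ 2 ≤ (j + 1) ^ 2 := Nat.pow_le_pow_left (Nat.le_succ j) 2
  omega

/-- Multiplication by the unit 1 + √2: (2i + o)² − 2(i + o)² = 2i² − o², so the comparison of o = 2r
+ 1 with i√2 is reversed. -/
theorem onesCount_block_succ (i : ℕ) :
    i + onesCount i + 1 ≤ onesCount (i + 2 * onesCount i + 1) := by
  rw [le_onesCount_iff]
  have h := (onesCount_lt_iff (onesCount i) i).1 le_rfl
  nlinarith

theorem onesCount_block_pred (i l : ℕ) (hl : l + 1 = i + 2 * onesCount i) :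
    onesCount l + 1 ≤ i + onesCount i := by
  rcases Nat.eq_zero_or_pos (onesCount i) with h0 | h0
  · rcases Nat.eq_zero_or_pos i with rfl | hi
    · simp [h0] at hl
    · have h := (onesCount_lt_iff (onesCount i) i).1 le_rfl
      rw [h0] at h
      nlinarith
  · obtain ⟨r, hr⟩ := Nat.exists_eq_succ_of_ne_zero h0.ne'
    have h := (le_onesCount_iff r i).1 (by omega)
    have h' := two_mul_sq_ne_sq_odd i r
    have h2 : (2 * r + 1) ^ 2 < 2 * i ^ 2 := lt_of_le_of_ne h h'.symm
    have : onesCount l ≤ i + r := by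
      rw [onesCount_lt_iff]
      have : l = i + 2 * r + 1 := by omega
      subst this
      nlinarith
    omega

theorem onesCount_block (i : ℕ) : onesCount (i + 2 * onesCount i) = i + onesCount i := by
  apply le_antisymm
  · rcases h : i + 2 * onesCount i with _ | l
    · simp [onesCount_zero]
    · exact (onesCount_succ_le l).trans (onesCount_block_pred i l h.symm)
  · have h1 := onesCount_block_succ i
    have h2 := onesCount_succ_le (i + 2 * onesCount i)
    omega

/-- The candidate for the `j`-th letter. -/
def stepLetter (j : ℕ) : Bool := decide (onesCount j < onesCount (j + 1))

/-- The first `n` candidate letters. -/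
def stepPrefix (n : ℕ) : List Bool := (List.range n).map stepLetter

theorem stepPrefix_succ (n : ℕ) : stepPrefix (n + 1) = stepPrefix n ++ [stepLetter n] := by
  simp [stepPrefix, List.range_succ]

/-- `onesCount_block` counts the ones up to a block boundary; `onesCount_block_succ` and
`onesCount_block_pred` force a one just after and just before it. In a block of length three the
middle letter is then 0. -/
theorem tau_stepPrefix (i : ℕ) : tau (stepPrefix i) = stepPrefix (i + 2 * onesCount i) := by
  induction i with
  | zero => simp [stepPrefix, tau, onesCount_zero]
  | succ i ih =>
    have hb := onesCount_block i
    have hs := onesCount_block_succ i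
    have hL : stepLetter (i + 2 * onesCount i) = true := by
      simp only [stepLetter, decide_eq_true_eq]; omega
    rw [stepPrefix_succ, tau_append, ih]
    have hm := onesCount_mono i
    have hsl := onesCount_succ_le i
    by_cases hc : onesCount i < onesCount (i + 1)
    · have e : onesCount (i + 1) = onesCount i + 1 := by omega
      have hb' := onesCount_block (i + 1)
      have hp := onesCount_block_pred (i + 1) (i + 2 * onesCount i + 2) (by omega)
      have e1 : i + 1 + 2 * onesCount (i + 1) = i + 2 * onesCount i + 2 + 1 := by omega
      rw [e1] at hb' ⊢
      have hm1 : onesCount (i + 2 * onesCount i + 1) ≤ onesCount (i + 2 * onesCount i + 2) :=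
        onesCount_mono _
      have h1 : stepLetter (i + 2 * onesCount i + 1) = false := by
        simp only [stepLetter, decide_eq_false_iff_not]
        rw [show i + 2 * onesCount i + 1 + 1 = i + 2 * onesCount i + 2 from rfl]
        omega
      have h2 : stepLetter (i + 2 * onesCount i + 2) = true := by
        simp only [stepLetter, decide_eq_true_eq]; omega
      have h3 : stepLetter i = true := by simpa [stepLetter] using hc
      rw [stepPrefix_succ, stepPrefix_succ, stepPrefix_succ, hL, h1, h2, h3]
      simp [tau, tauLetter]
    · have e : onesCount (i + 1) = onesCount i := by omega
      have h3 : stepLetter i = false := by simpa [stepLetter] using hc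
      have e1 : i + 1 + 2 * onesCount (i + 1) = i + 2 * onesCount i + 1 := by omega
      rw [e1, stepPrefix_succ, hL, h3]
      simp [tau, tauLetter]

theorem exists_tauIter_eq_stepPrefix (n : ℕ) : ∃ l, tauIter n [true] = stepPrefix l := by
  induction n with
  | zero => exact ⟨1, by simp [tauIter, stepPrefix, stepLetter, onesCount]⟩
  | succ n ih =>
    obtain ⟨l, hl⟩ := ih
    exact ⟨_, by rw [tauIter_succ, hl, tau_stepPrefix]⟩

theorem sLetter_eq (j : ℕ) : sLetter j = stepLetter j := by
  obtain ⟨l, hl⟩ := exists_tauIter_eq_stepPrefix j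
  unfold sLetter
  simp [hl, stepPrefix]

/-! ### Convergents of √2 and the floor formula. -/

/-- `(q, p)` with `p / q` the `k`-th convergent of `√2`. -/
def pell : ℕ → ℕ × ℕ
  | 0 => (1, 1)
  | k + 1 => ((pell k).1 + (pell k).2, 2 * (pell k).1 + (pell k).2)

theorem pell_norm (k : ℕ) :
    ((pell k).2 : ℤ) ^ 2 - 2 * ((pell k).1 : ℤ) ^ 2 = (-1) ^ (k + 1) := by
  induction k with
  | zero => simp [pell]
  | succ k ih =>
    rw [pow_succ (-1 : ℤ) (k + 1), ← ih]
    simp only [pell]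
    push_cast
    ring

theorem pell_pos (k : ℕ) : 0 < (pell k).1 ∧ 0 < (pell k).2 := by
  induction k with
  | zero => simp [pell]
  | succ k ih => simp only [pell]; omega

theorem count_length_tau (w : List Bool) :
    (tau w).length = w.length + 2 * w.count true ∧
      (tau w).count true = w.length + w.count true := by
  induction w with
  | nil => simp [tau]
  | cons a w ih =>
    have h : tau (a :: w) = tauLetter a ++ tau w := by simp [tau]
    rw [h]
    cases a <;> simp [tauLetter, ih.1, ih.2] <;> omega

theorem count_length_tauIter (k : ℕ) :
    (tauIter k [true, false]).length = 2 * (pell k).1 ∧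
      (tauIter k [true, false]).count true = (pell k).2 := by
  induction k with
  | zero => simp [tauIter, pell]
  | succ k ih =>
    have := count_length_tau (tauIter k [true, false])
    rw [tauIter_succ, this.1, this.2, ih.1, ih.2]
    exact ⟨by simp only [pell]; ring, rfl⟩

theorem f_odd (k : ℕ) : f (2 * k + 1) = 2 * (pell k).1 := by
  have h : ¬ Even (2 * k + 1) := by simp
  have h2 : (2 * k + 1) / 2 = k := by omega
  rw [f, if_neg h, h2, (count_length_tauIter k).1]

/-- Here −(Pt + Qv) plays the role of j. Signs and the norm exclude everything except t ≤ −1, v ≤ −3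
(v is odd), where j ≥ P + 3Q; this is the source of the bound. -/
theorem neg_norm_region {P Q t v : ℤ} (hQ : 0 < Q) (hP : 0 < P) (h : P ^ 2 - 2 * Q ^ 2 = -1)
    (hv : Odd v) (hj : 0 < -(P * t + Q * v)) (hj' : -(P * t + Q * v) < P + 3 * Q)
    (ho : 0 < -(2 * Q * t + P * v)) : 2 * t ^ 2 ≤ v ^ 2 ↔ 0 ≤ t := by
  constructor
  · intro h1
    by_contra! ht
    rcases le_or_gt v 0 with hv0 | hv0
    · have hv3 : v ≤ -3 := by
        by_contra! h5
        obtain ⟨u, rfl⟩ := hv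
        have : u = -1 := by omega
        subst this
        nlinarith
      nlinarith [mul_nonneg hQ.le (show 0 ≤ -3 - v by omega),
        mul_nonneg hP.le (show 0 ≤ -1 - t by omega)]
    · have h7 : (Q * v) ^ 2 < (P * -t) ^ 2 :=
        pow_lt_pow_left₀ (by linarith) (by positivity) two_ne_zero
      have h8 : Q ^ 2 * (2 * t ^ 2) ≤ Q ^ 2 * v ^ 2 := by gcongr
      have h9 : (P ^ 2 - 2 * Q ^ 2) * t ^ 2 = -t ^ 2 := by rw [h]; ring
      nlinarith [sq_nonneg t]
  · intro ht
    by_contra! h1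
    have h5 : P * t < Q * -v := by linarith
    have h6 : 2 * Q * t < P * -v := by linarith
    have h7 : (2 * Q * t) ^ 2 < (P * -v) ^ 2 :=
      pow_lt_pow_left₀ h6 (by positivity) two_ne_zero
    have h8 : P ^ 2 * v ^ 2 ≤ P ^ 2 * (2 * t ^ 2) := by gcongr
    have h9 : (P ^ 2 - 2 * Q ^ 2) * t ^ 2 = -t ^ 2 := by rw [h]; ring
    nlinarith [sq_nonneg t]

theorem norm_region {P Q t v : ℤ} (hQ : 0 < Q) (hP : 0 < P) (h : P ^ 2 - 2 * Q ^ 2 = 1)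
    (hv : Odd v) (hj : 0 < P * t + Q * v) (hj' : P * t + Q * v < P + 3 * Q)
    (ho : 0 < 2 * Q * t + P * v) : v ^ 2 ≤ 2 * t ^ 2 ↔ 1 ≤ t := by
  constructor
  · intro h1
    by_contra! ht
    have h7 : (P * -t) ^ 2 < (Q * v) ^ 2 :=
      pow_lt_pow_left₀ (by linarith) (mul_nonneg hP.le (by omega)) two_ne_zero
    have h8 : Q ^ 2 * v ^ 2 ≤ Q ^ 2 * (2 * t ^ 2) := by gcongr
    have h9 : (P ^ 2 - 2 * Q ^ 2) * t ^ 2 = t ^ 2 := by rw [h]; ring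
    nlinarith [sq_nonneg t]
  · intro ht
    by_contra! h1
    rcases le_or_gt v 0 with hv0 | hv0
    · have h7 : (P * -v) ^ 2 < (2 * Q * t) ^ 2 :=
        pow_lt_pow_left₀ (by linarith) (mul_nonneg hP.le (by omega)) two_ne_zero
      have h8 : P ^ 2 * (2 * t ^ 2) ≤ P ^ 2 * v ^ 2 := by gcongr
      have h9 : (P ^ 2 - 2 * Q ^ 2) * t ^ 2 = t ^ 2 := by rw [h]; ring
      nlinarith [sq_nonneg t]
    · have hv3 : 3 ≤ v := by
        by_contra! h5
        obtain ⟨u, rfl⟩ := hv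
        have : u = 0 := by omega
        subst this
        nlinarith
      nlinarith [mul_nonneg hQ.le (show 0 ≤ v - 3 by omega),
        mul_nonneg hP.le (show 0 ≤ t - 1 by omega)]

/-- The nearest integer to `j / √2` may be computed with a convergent `P / Q` of `√2`. -/
theorem onesCount_eq_div (P Q b : ℕ) (hQ : 0 < Q) (hP : 0 < P) (hodd : Odd P)
    (h : ((P : ℤ) ^ 2 - 2 * Q ^ 2 = -1 ∧ b = Q) ∨ ((P : ℤ) ^ 2 - 2 * Q ^ 2 = 1 ∧ b + 1 = Q))
    (j : ℕ) (hj : j < P + 3 * Q) : onesCount j = (P * j + b) / (2 * Q) := by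
  rcases Nat.eq_zero_or_pos j with rfl | hj0
  · rw [onesCount_zero, eq_comm]
    apply Nat.div_eq_of_lt
    omega
  refine eq_of_forall_le_iff fun r => ?_
  rcases r with _ | r
  · simp
  rw [le_onesCount_iff, Nat.le_div_iff_mul_le (by omega)]
  obtain ⟨c, hc⟩ := hodd
  zify
  obtain ⟨o, ho⟩ : ∃ o : ℤ, o = 2 * (r : ℤ) + 1 := ⟨_, rfl⟩
  -- v + t√2 = (o + j√2)(P − Q√2), so the norm o² − 2j² is preserved up to the sign e.
  obtain ⟨t, ht⟩ : ∃ t : ℤ, t = P * j - Q * o := ⟨_, rfl⟩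
  obtain ⟨v, hv⟩ : ∃ v : ℤ, v = P * o - 2 * Q * j := ⟨_, rfl⟩
  have hvodd : Odd v := ⟨c * o + r - Q * j, by rw [hv, hc, ho]; push_cast; ring⟩
  have hjZ : (j : ℤ) < P + 3 * Q := by exact_mod_cast hj
  have hj0' : (0 : ℤ) < j := by exact_mod_cast hj0
  have hQ' : (0 : ℤ) < Q := by exact_mod_cast hQ
  have hP' : (0 : ℤ) < P := by exact_mod_cast hP
  have ho0 : 0 < o := by omega
  -- The floor inequality becomes t ≥ Q − b, that is t ≥ 0 or t ≥ 1 according to the norm.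
  have hr : ((r : ℤ) + 1) * (2 * Q) = Q * o + Q := by rw [ho]; ring
  rw [hr, ← ho]
  rcases h with ⟨h, hb⟩ | ⟨h, hb⟩
  · have key : v ^ 2 - 2 * t ^ 2 = 2 * (j : ℤ) ^ 2 - o ^ 2 := by
      rw [ht, hv]; linear_combination (o ^ 2 - 2 * (j : ℤ) ^ 2) * h
    have ej : (j : ℤ) = -(P * t + Q * v) := by
      rw [ht, hv]; linear_combination (j : ℤ) * h
    have eo : o = -(2 * Q * t + P * v) := by
      rw [ht, hv]; linear_combination o * h
    have := neg_norm_region hQ' hP' h hvodd (by rwa [← ej]) (by rwa [← ej]) (by rwa [← eo])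
    rw [show o ^ 2 ≤ 2 * (j : ℤ) ^ 2 ↔ 2 * t ^ 2 ≤ v ^ 2 by constructor <;> intro <;> linarith,
      this, hb]
    constructor <;> intro <;> linarith
  · have key : v ^ 2 - 2 * t ^ 2 = o ^ 2 - 2 * (j : ℤ) ^ 2 := by
      rw [ht, hv]; linear_combination (o ^ 2 - 2 * (j : ℤ) ^ 2) * h
    have ej : (j : ℤ) = P * t + Q * v := by
      rw [ht, hv]; linear_combination (-(j : ℤ)) * h
    have eo : o = 2 * Q * t + P * v := by
      rw [ht, hv]; linear_combination (-o) * h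
    have := norm_region hQ' hP' h hvodd (by rwa [← ej]) (by rwa [← ej]) (by rwa [← eo])
    rw [show o ^ 2 ≤ 2 * (j : ℤ) ^ 2 ↔ v ^ 2 ≤ 2 * t ^ 2 by constructor <;> intro <;> linarith,
      this]
    have hb' : (b : ℤ) = Q - 1 := by omega
    rw [hb']
    constructor <;> intro <;> linarith

/-- The floor increases exactly when adding P to the residue modulo 2Q carries. -/
theorem s_eq_ite (P Q b : ℕ) (hQ : 0 < Q) (hP : 0 < P) (hPQ : P < 2 * Q) (hodd : Odd P)
    (h : ((P : ℤ) ^ 2 - 2 * Q ^ 2 = -1 ∧ b = Q) ∨ ((P : ℤ) ^ 2 - 2 * Q ^ 2 = 1 ∧ b + 1 = Q))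
    (j : ℕ) (hj : j + 1 < P + 3 * Q) :
    s j = if 2 * Q ≤ (P * j + b) % (2 * Q) + P then 1 else 0 := by
  have h1 := onesCount_eq_div P Q b hQ hP hodd h j (by omega)
  have h2 := onesCount_eq_div P Q b hQ hP hodd h (j + 1) hj
  have e : P * (j + 1) + b = P * j + b + P := by ring
  have hiff : (P * j + b) / (2 * Q) < (P * j + b + P) / (2 * Q) ↔
      2 * Q ≤ (P * j + b) % (2 * Q) + P := by
    have h3 : P / (2 * Q) = 0 := Nat.div_eq_of_lt hPQ
    have h4 : P % (2 * Q) = P := Nat.mod_eq_of_lt hPQ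
    rw [Nat.add_div (a := P * j + b) (b := P) (by omega), h3, h4]
    split_ifs <;> omega
  simp only [s, sLetter_eq, stepLetter, h1, h2, e, hiff, decide_eq_true_eq]

end HankelTau

/-! ### Shift matrices and signs of reflections over ℤ/(n+1). -/

namespace HankelTau

open Matrix

/-- The difference of a shift by `d` and the identity, plus a constant. -/
def shiftSub {n : ℕ} (d : ZMod (n + 1)) (t : ℚ) : Matrix (ZMod (n + 1)) (ZMod (n + 1)) ℚ :=
  of fun i j => (if j = i + d then 1 else 0) - (if j = i then 1 else 0) + t

theorem shiftSub_mulVec {n : ℕ} (d : ZMod (n + 1)) (t : ℚ) (v : ZMod (n + 1) → ℚ)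
    (i : ZMod (n + 1)) : (shiftSub d t *ᵥ v) i = v (i + d) - v i + t * ∑ j, v j := by
  simp [mulVec, dotProduct, shiftSub, add_mul, sub_mul, Finset.sum_add_distrib,
    Finset.sum_sub_distrib, Finset.mul_sum]

theorem eq_of_forall_add_eq {n : ℕ} {d : ZMod (n + 1)} (hd : IsUnit d) {v : ZMod (n + 1) → ℚ}
    (hv : ∀ i, v (i + d) = v i) (i : ZMod (n + 1)) : v i = v 0 := by
  have h : ∀ m : ℕ, v (m * d) = v 0 := by
    intro m
    induction m with
    | zero => simp
    | succ m ih => rw [← ih, ← hv (m * d)]; push_cast; ring_nf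
  obtain ⟨u, rfl⟩ := hd
  have := h (i * (↑u⁻¹ : ZMod (n + 1))).val
  rwa [ZMod.natCast_zmod_val, mul_assoc, Units.inv_mul, mul_one] at this

/-- Summing the kernel equations gives total zero; a kernel vector is then invariant under the
generator d, hence constant, hence zero. -/
theorem det_shiftSub_ne_zero {n : ℕ} {d : ZMod (n + 1)} (hd : IsUnit d) :
    (shiftSub d 1).det ≠ 0 := by
  intro h
  obtain ⟨v, hv0, hv⟩ := exists_mulVec_eq_zero_iff.2 h
  have h1 : ∀ i, v (i + d) - v i + ∑ j, v j = 0 := fun i => by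
    have := congrFun hv i
    rwa [shiftSub_mulVec, one_mul] at this
  have h2 : ∑ i, (v (i + d) - v i + ∑ j, v j) = 0 := Finset.sum_eq_zero fun i _ => h1 i
  have h3 : ∑ i, v (i + d) = ∑ i, v i := Equiv.sum_comp (Equiv.addRight d) v
  rw [Finset.sum_add_distrib, Finset.sum_sub_distrib, h3, sub_self, zero_add, Finset.sum_const,
    Finset.card_univ, ZMod.card, smul_eq_zero] at h2
  have h4 : ∑ j, v j = 0 := h2.resolve_left (Nat.succ_ne_zero n)
  have h5 := eq_of_forall_add_eq hd (v := v) fun i => by linarith [h1 i]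
  rw [Finset.sum_congr rfl fun i _ => h5 i, Finset.sum_const, Finset.card_univ, ZMod.card,
    smul_eq_zero] at h4
  have h6 : v 0 = 0 := h4.resolve_left (Nat.succ_ne_zero n)
  exact hv0 (funext fun i => by rw [h5 i, h6]; rfl)

/-- Constant vectors have eigenvalue n + 1 under `shiftSub d 1`, so the constant 1 is changed to t
by a rank-one factor of determinant t. -/
theorem det_shiftSub_const {n : ℕ} (d : ZMod (n + 1)) (t : ℚ) :
    (shiftSub d t).det = t * (shiftSub d 1).det := by
  set c : ℚ := (t - 1) / (n + 1) with hc
  have hn : (n + 1 : ℚ) ≠ 0 := by positivity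
  have h1 : shiftSub d t = shiftSub d 1 *
      (1 + replicateCol Unit (fun _ : ZMod (n + 1) => c) *
        replicateRow Unit (fun _ : ZMod (n + 1) => (1 : ℚ))) := by
    ext i j
    rw [mul_add, mul_one, Matrix.add_apply]
    have : ((shiftSub d 1) * (replicateCol Unit (fun _ : ZMod (n + 1) => c) *
        replicateRow Unit (fun _ : ZMod (n + 1) => (1 : ℚ)))) i j =
        (shiftSub d 1 *ᵥ fun _ => c) i := by
      simp [Matrix.mul_apply, mulVec, dotProduct]
    rw [this, shiftSub_mulVec]
    simp [shiftSub, ZMod.card, hc]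
    field_simp
    ring
  rw [h1, det_mul, det_one_add_replicateCol_mul_replicateRow, mul_comm]
  congr 1
  simp [dotProduct, ZMod.card, hc]
  field_simp
  ring

theorem det_shiftSub_unit {n : ℕ} {d : ZMod (n + 1)} (hd : IsUnit d) (t : ℚ) :
    (shiftSub d t).det = (shiftSub (1 : ZMod (n + 1)) t).det := by
  obtain ⟨u, rfl⟩ := hd
  rw [← det_submatrix_equiv_self (Units.mulLeft u)]
  congr 1
  ext i j
  have : (↑u * j = ↑u * i + ↑u) ↔ j = i + 1 := by
    rw [show (↑u * i + ↑u : ZMod (n + 1)) = ↑u * (i + 1) by ring]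
    exact Units.mul_right_inj u
  simp [shiftSub, this]

/-- The residues `0, …, n` modulo `n + 1`. -/
def finZMod (n : ℕ) : Fin (n + 1) ≃ ZMod (n + 1) where
  toFun i := ((i : ℕ) : ZMod (n + 1))
  invFun x := ⟨x.val, x.val_lt⟩
  left_inv i := by simp [ZMod.val_cast_of_lt i.isLt]
  right_inv x := by simp

theorem finZMod_apply {n : ℕ} (i : Fin (n + 1)) : finZMod n i = ((i : ℕ) : ZMod (n + 1)) := rfl

theorem finZMod_last (n : ℕ) : finZMod n (Fin.last n) = -1 := by
  rw [finZMod_apply, Fin.val_last, eq_neg_iff_add_eq_zero]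
  exact_mod_cast ZMod.natCast_self (n + 1)

theorem sign_addRight_one {n : ℕ} :
    Equiv.Perm.sign (Equiv.addRight (1 : ZMod (n + 1))) = (-1) ^ n := by
  have : Equiv.addRight (1 : ZMod (n + 1)) = (finZMod n).permCongr (finRotate (n + 1)) := by
    ext x
    obtain ⟨i, rfl⟩ := (finZMod n).surjective x
    rw [Equiv.permCongr_apply, Equiv.symm_apply_apply]
    simp [finZMod_apply, Fin.val_add]
  rw [this, Equiv.Perm.sign_permCongr, sign_finRotate, Nat.add_sub_cancel]

theorem sign_revPerm (Q : ℕ) :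
    Equiv.Perm.sign (Fin.revPerm : Equiv.Perm (Fin (2 * Q))) = (-1) ^ Q := by
  rw [Equiv.Perm.sign_eq_prod_prod_Iio]
  have h : ∀ j : Fin (2 * Q), (∏ i ∈ Finset.Iio j,
      if Fin.revPerm i < Fin.revPerm j then (1 : ℤˣ) else -1) = (-1) ^ (j : ℕ) := by
    intro j
    rw [Finset.prod_congr rfl (g := fun _ => -1), Finset.prod_const, Fin.card_Iio]
    intro i hi
    rw [if_neg]
    simpa using (Finset.mem_Iio.1 hi).le
  rw [Finset.prod_congr rfl fun j _ => h j, Finset.prod_pow_eq_pow_sum,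
    Fin.sum_univ_eq_sum_range (fun j => j), Finset.sum_range_id, mul_assoc,
    Nat.mul_div_cancel_left _ two_pos, pow_mul]
  rcases Q with _ | Q
  · simp
  · rw [pow_right_comm, Odd.neg_one_pow ⟨Q, by omega⟩]

theorem sign_subLeft_neg_one_sub {n : ℕ} (Q : ℕ) (hn : n + 1 = 2 * Q) (c : ℕ) :
    Equiv.Perm.sign (Equiv.subLeft (-1 - (c : ZMod (n + 1)))) = (-1) ^ (Q + c) := by
  induction c with
  | zero =>
    have : Equiv.subLeft (-1 - ((0 : ℕ) : ZMod (n + 1))) = (finZMod n).permCongr Fin.revPerm := by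
      ext x
      obtain ⟨i, rfl⟩ := (finZMod n).surjective x
      have h := finZMod_last n
      rw [finZMod_apply, Fin.val_last] at h
      have hi : n + 1 - ((i : ℕ) + 1) = n - i := by omega
      rw [Equiv.permCongr_apply, Equiv.symm_apply_apply]
      simp [finZMod_apply, hi, Nat.cast_sub (Fin.is_le i), h]
    have h : Equiv.Perm.sign (Fin.revPerm : Equiv.Perm (Fin (n + 1))) = (-1) ^ Q := by
      rw [hn]; exact sign_revPerm Q
    rw [this, Equiv.Perm.sign_permCongr, h, add_zero]
  | succ c ih =>
    have : Equiv.subLeft (-1 - (c : ZMod (n + 1))) =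
        Equiv.addRight 1 * Equiv.subLeft (-1 - ((c + 1 : ℕ) : ZMod (n + 1))) := by
      ext i
      simp
      ring
    rw [this, Equiv.Perm.sign_mul, sign_addRight_one, Odd.neg_one_pow ⟨Q - 1, by omega⟩] at ih
    rw [← add_assoc, pow_succ, ← ih]
    simp

end HankelTau

/-! ### The minor of a periodic Hankel matrix. -/

namespace HankelTau

open Matrix

/-- A maximal minor of a periodic Hankel matrix whose rows `i` and `i + d` differ by a signed pair
of adjacent unit vectors. -/
theorem det_periodic_hankel {n : ℕ} {g h : ZMod (n + 1) → ℚ} {d a : ZMod (n + 1)} {P : ℚ}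
    (hP : P ≠ 0) (hd : IsUnit d) (hn : Even (n + 1))
    (hsign : Equiv.Perm.sign (Equiv.subLeft a) = 1)
    (hg : ∀ x, g (x + d) - g x = (if x = a then 1 else 0) - if x = a + 1 then 1 else 0)
    (hgs : ∑ x, g x = P)
    (hh : ∀ x, h (x - 1) - h x =
      P * ((if x = a + 2 + d then 1 else 0) - if x = a + 2 then 1 else 0))
    (hhs : ∑ x, h x = 1) :
    (of fun i j : Fin n => g ((i + j : ℕ) : ZMod (n + 1))).det = -h (-1) := by
  set A : Matrix (ZMod (n + 1)) (ZMod (n + 1)) ℚ := shiftSub d 1 with hA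
  set C : Matrix (ZMod (n + 1)) (ZMod (n + 1)) ℚ := of fun i j => g (i + j) with hC
  set E : Matrix (ZMod (n + 1)) (ZMod (n + 1)) ℚ := of fun i j =>
    (if i + j = a then 1 else 0) - (if i + j = a + 1 then 1 else 0) + P with hE
  have hAdet : A.det ≠ 0 := det_shiftSub_ne_zero hd
  have hAC : A * C = E := by
    ext i j
    have h1 : (A * C) i j = (A *ᵥ fun k => C k j) i := rfl
    have h2 : ∑ k, g (k + j) = P := (Equiv.sum_comp (Equiv.addRight j) g).trans hgs
    have h3 := hg (i + j)
    rw [h1, hA, shiftSub_mulVec]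
    simp only [hC, hE, of_apply, h2, one_mul, ← h3, add_right_comm i d j]
  have hEdet : E.det = -P * A.det := by
    have h1 : E = (-shiftSub 1 (-P)).submatrix (Equiv.subLeft a) id := by
      ext i j
      have e1 : j = a - i + 1 ↔ i + j = a + 1 := by
        constructor <;> intro e <;> linear_combination e
      have e2 : j = a - i ↔ i + j = a := by
        constructor <;> intro e <;> linear_combination e
      rw [submatrix_apply, Matrix.neg_apply]
      simp only [hE, shiftSub, of_apply, Equiv.subLeft_apply, id, e1, e2]
      ring
    rw [h1, det_permute, hsign, det_neg, ZMod.card, hn.neg_one_pow, det_shiftSub_const, hA,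
      det_shiftSub_unit hd]
    simp
  have hCdet : C.det = -P := by
    have := congrArg det hAC
    rw [det_mul, hEdet] at this
    exact mul_left_cancel₀ hAdet (by linarith)
  -- Since A is invertible, it suffices to compare both sides after applying A, where AC = E is
  -- explicit.
  have hCh : C *ᵥ h = Pi.single (-1) P := by
    rw [← sub_eq_zero]
    apply eq_zero_of_mulVec_eq_zero hAdet
    rw [mulVec_sub, mulVec_mulVec, hAC, sub_eq_zero]
    ext i
    rw [hA, shiftSub_mulVec]
    have h1 : (E *ᵥ h) i = h (a - i) - h (a + 1 - i) + P * ∑ j, h j := by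
      have e1 : ∀ j, i + j = a + 1 ↔ j = a + 1 - i := fun j => by
        constructor <;> intro e <;> linear_combination e
      have e2 : ∀ j, i + j = a ↔ j = a - i := fun j => by
        constructor <;> intro e <;> linear_combination e
      simp [mulVec, dotProduct, hE, e1, e2, add_mul, sub_mul, Finset.sum_add_distrib,
        Finset.sum_sub_distrib, Finset.mul_sum]
    have h2 := hh (a + 1 - i)
    have e0 : a + 1 - i - 1 = a - i := by ring
    have e1 : a + 1 - i = a + 2 + d ↔ i + d = -1 := by
      constructor <;> intro e <;> linear_combination -e
    have e2 : a + 1 - i = a + 2 ↔ i = -1 := by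
      constructor <;> intro e <;> linear_combination -e
    rw [e0] at h2
    simp only [e1, e2] at h2
    rw [h1, h2, hhs]
    simp [Pi.single_apply]
    split_ifs <;> ring
  set C' : Matrix (Fin (n + 1)) (Fin (n + 1)) ℚ := C.submatrix (finZMod n) (finZMod n) with hC'
  have hC'det : C'.det = -P := by rw [hC', det_submatrix_equiv_self, hCdet]
  have hC'h : C' *ᵥ (h ∘ finZMod n) = Pi.single (Fin.last n) P := by
    rw [hC', submatrix_mulVec_equiv, Function.comp_assoc, Equiv.self_comp_symm, Function.comp_id,
      hCh]
    ext i
    simp only [Function.comp_apply, Pi.single_apply, ← finZMod_last n,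
      (finZMod n).injective.eq_iff]
  -- Cramer's rule: the last coordinate isolates the cofactor obtained by deleting the residue −1.
  have hadj : C'.adjugate *ᵥ (C' *ᵥ (h ∘ finZMod n)) = -P • (h ∘ finZMod n) := by
    rw [mulVec_mulVec, adjugate_mul, hC'det, smul_mulVec, one_mulVec]
  have hlast := congrFun hadj (Fin.last n)
  have hminor : C'.submatrix (Fin.last n).succAbove (Fin.last n).succAbove =
      of fun i j : Fin n => g ((i + j : ℕ) : ZMod (n + 1)) := by
    ext i j
    simp [hC', hC, finZMod_apply]
  rw [hC'h, mulVec_single] at hlast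
  simp only [Pi.smul_apply, col_apply, Function.comp_apply, finZMod_last, op_smul_eq_mul,
    adjugate_fin_succ_eq_det_submatrix, hminor, smul_eq_mul, Fin.val_last,
    Even.neg_one_pow (Even.add_self n), one_mul] at hlast
  apply mul_right_cancel₀ hP
  rw [hlast]
  ring

/-! ### Coding of the rotation, and the determinant at a convergent. -/

/-- Indicator function of the top `P` residues modulo `n + 1`. -/
def topInd (n P : ℕ) (x : ZMod (n + 1)) : ℚ := if n + 1 ≤ x.val + P then 1 else 0

theorem topInd_natCast (n P i : ℕ) :
    topInd n P (i : ZMod (n + 1)) = if n + 1 ≤ i % (n + 1) + P then 1 else 0 := by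
  rw [topInd, ZMod.val_natCast]

theorem natCast_eq_iff {n i j : ℕ} (hi : i ≤ n) (hj : j ≤ n) :
    (i : ZMod (n + 1)) = j ↔ i = j := by
  rw [ZMod.natCast_eq_natCast_iff', Nat.mod_eq_of_lt (by omega), Nat.mod_eq_of_lt (by omega)]

theorem topInd_add_one {n P : ℕ} (hP0 : 0 < P) (hP : P < n + 1) (x : ZMod (n + 1)) :
    topInd n P (x + 1) - topInd n P x =
      (if x = -P - 1 then 1 else 0) - if x = -1 then 1 else 0 := by
  obtain ⟨i, rfl⟩ := (finZMod n).surjective x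
  have hi := i.is_le
  have h1 : (-1 : ZMod (n + 1)) = (n : ℕ) := by rw [← finZMod_last n, finZMod_apply, Fin.val_last]
  have h2 : (-P - 1 : ZMod (n + 1)) = ((n - P : ℕ) : ZMod (n + 1)) := by
    rw [Nat.cast_sub (by omega), ← h1]; ring
  have h3 : ((i : ℕ) : ZMod (n + 1)) + 1 = ((i + 1 : ℕ) : ZMod (n + 1)) := by push_cast; rfl
  rw [h2, h1, finZMod_apply, h3, topInd_natCast, topInd_natCast]
  simp only [natCast_eq_iff hi le_rfl, natCast_eq_iff hi (Nat.sub_le n P)]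
  rw [Nat.mod_eq_of_lt (show (i : ℕ) < n + 1 by omega)]
  rcases hi.lt_or_eq with h | h
  · rw [Nat.mod_eq_of_lt (by omega)]
    split_ifs <;> first | omega | norm_num
  · rw [h, Nat.mod_self]
    split_ifs <;> first | omega | norm_num

theorem sum_topInd {n P : ℕ} (hP : P < n + 1) : ∑ x, topInd n P x = P := by
  rw [← Equiv.sum_comp (finZMod n)]
  have h : ∀ i : Fin (n + 1), topInd n P (finZMod n i) = if n + 1 ≤ (i : ℕ) + P then 1 else 0 := by
    intro i
    rw [finZMod_apply, topInd_natCast, Nat.mod_eq_of_lt i.isLt]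
  rw [Finset.sum_congr rfl fun i _ => h i,
    Fin.sum_univ_eq_sum_range (fun i => if n + 1 ≤ i + P then (1 : ℚ) else 0), Finset.sum_boole]
  have : Finset.filter (fun i => n + 1 ≤ i + P) (Finset.range (n + 1)) =
      Finset.Ico (n + 1 - P) (n + 1) := by
    ext i
    simp only [Finset.mem_filter, Finset.mem_range, Finset.mem_Ico]
    omega
  rw [this, Nat.card_Ico, Nat.sub_sub_self hP.le]

theorem odd_and_parity {P Q : ℕ} {e : ℤ} (he : e = 1 ∨ e = -1)
    (h : (P : ℤ) ^ 2 - 2 * Q ^ 2 = e) : Odd P ∧ (e = 1 → Even Q) ∧ (e = -1 → Odd Q) := by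
  have hP : Odd P := by
    rw [← Int.odd_coe_nat, ← Int.odd_pow' (two_ne_zero), sub_eq_iff_eq_add.1 h]
    rcases he with rfl | rfl
    · exact ⟨Q ^ 2, by ring⟩
    · exact ⟨Q ^ 2 - 1, by ring⟩
  obtain ⟨c, rfl⟩ := hP
  refine ⟨⟨c, rfl⟩, fun h1 => ?_, fun h1 => ?_⟩
  · rw [← Int.even_coe_nat, ← Int.even_pow' two_ne_zero]
    exact ⟨(c : ℤ) ^ 2 + c, by push_cast at h; linarith⟩
  · rw [← Int.odd_coe_nat, ← Int.odd_pow' two_ne_zero]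
    exact ⟨(c : ℤ) ^ 2 + c, by push_cast at h; linarith⟩

theorem H_convergent {P Q m n : ℕ} {e : ℤ} (he : e = 1 ∨ e = -1)
    (h : (P : ℤ) ^ 2 - 2 * Q ^ 2 = e) (hQ : 0 < Q) (hQP : Q ≤ P) (hP2 : P < 2 * Q)
    (hm : m + Q = P + 1) (hn : n + 1 = 2 * Q) : H m n = e * (Q - P) := by
  obtain ⟨hPodd, hQe, hQo⟩ := odd_and_parity he h
  have hP0 : 0 < P := by omega
  have h2Q : (2 * Q : ZMod (n + 1)) = 0 := by
    have h1 : ((n + 1 : ℕ) : ZMod (n + 1)) = ((2 * Q : ℕ) : ZMod (n + 1)) := congrArg _ hn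
    rw [ZMod.natCast_self] at h1
    exact_mod_cast h1.symm
  -- The point a + 1 is coded by the residue −1, where `topInd` drops. The parity of Q makes the
  -- reflection through a an even permutation.
  obtain ⟨b, a, hb, ha, hsign, ha2⟩ : ∃ (b : ℕ) (a : ZMod (n + 1)),
      (((P : ℤ) ^ 2 - 2 * Q ^ 2 = -1 ∧ b = Q) ∨ ((P : ℤ) ^ 2 - 2 * Q ^ 2 = 1 ∧ b + 1 = Q)) ∧
      (P * (a + 1 + m) + b : ZMod (n + 1)) = -1 ∧
      Equiv.Perm.sign (Equiv.subLeft a) = 1 ∧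
      (e = 1 ∧ a + 2 = -P ∨ e = -1 ∧ a + 2 = 0) := by
    have hPQ : (P * Q : ZMod (n + 1)) = Q := by
      obtain ⟨c, rfl⟩ := hPodd
      push_cast
      linear_combination (c : ZMod (n + 1)) * h2Q
    have hm' : (m + Q : ZMod (n + 1)) = P + 1 := by exact_mod_cast congrArg _ hm
    have hPP : ((P : ZMod (n + 1)) ^ 2 - 2 * Q ^ 2) = e := by
      have := congrArg (Int.cast : ℤ → ZMod (n + 1)) h
      push_cast at this
      exact this
    rcases he with rfl | rfl
    · refine ⟨Q - 1, -1 - ((P + 1 : ℕ) : ZMod (n + 1)), Or.inr ⟨h, by omega⟩, ?_, ?_, Or.inl ⟨rfl, ?_⟩⟩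
      · rw [Nat.cast_sub hQ]
        push_cast
        linear_combination (P : ZMod (n + 1)) * hm' - hPQ
      · rw [sign_subLeft_neg_one_sub Q hn, Even.neg_one_pow]
        exact (hQe rfl).add hPodd.add_one
      · push_cast; ring
    · refine ⟨Q, -1 - ((1 : ℕ) : ZMod (n + 1)), Or.inl ⟨h, rfl⟩, ?_, ?_, Or.inr ⟨rfl, ?_⟩⟩
      · push_cast at hPP ⊢
        linear_combination (P : ZMod (n + 1)) * hm' - hPQ + hPP + (Q : ZMod (n + 1)) * h2Q
      · rw [sign_subLeft_neg_one_sub Q hn, Even.neg_one_pow]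
        exact (hQo rfl).add_one
      · push_cast; ring
  have hee : (e : ℚ) * e = 1 := by rcases he with rfl | rfl <;> norm_num
  have hPd : (P * (e * P) : ZMod (n + 1)) = 1 := by
    have h1 := congrArg (Int.cast : ℤ → ZMod (n + 1)) h
    have h2 : (e * e : ZMod (n + 1)) = 1 := by rcases he with rfl | rfl <;> norm_num
    push_cast at h1
    linear_combination (e : ZMod (n + 1)) * h1 + h2 + (e : ZMod (n + 1)) * Q * h2Q
  have hcast : (H m n : ℚ) = (of fun i j : Fin n =>
      topInd n P (P * (((i + j : ℕ) : ZMod (n + 1)) + m) + b)).det := by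
    rw [H, ← eq_intCast (Int.castRingHom ℚ), RingHom.map_det]
    congr 1
    ext i j
    have hi := i.isLt
    have hj := j.isLt
    have e1 : (P * (((i + j : ℕ) : ZMod (n + 1)) + m) + b : ZMod (n + 1)) =
        ((P * (m + i + j) + b : ℕ) : ZMod (n + 1)) := by push_cast; ring
    rw [RingHom.mapMatrix_apply, map_apply, of_apply, e1, topInd_natCast, hn]
    simp only [hankelMatrix, of_apply]
    -- The largest index is m + 2(n − 1) = P + 3Q − 3, inside the range of the floor formula.
    rw [s_eq_ite P Q b hQ hP0 hP2 hPodd hb _ (by omega)]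
    split_ifs <;> simp
  -- The term −Q in h normalises its sum: e(P·P − 2Q·Q) = e² = 1.
  have hmain := det_periodic_hankel (n := n) (P := P) (d := e * P) (a := a)
    (g := fun x => topInd n P (P * (x + m) + b)) (h := fun x => e * (P * topInd n P x - Q))
    (by exact_mod_cast hP0.ne') (IsUnit.of_mul_eq_one (P : ZMod (n + 1)) (by rw [mul_comm, hPd]))
    ⟨Q, by omega⟩ hsign ?_ ?_ ?_ ?_
  · have h1 : topInd n P (-1) = 1 := by
      rw [← finZMod_last n, finZMod_apply, Fin.val_last, topInd_natCast,
        Nat.mod_eq_of_lt n.lt_succ_self, if_pos (by omega)]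
    have : (H m n : ℚ) = ((e * (Q - P) : ℤ) : ℚ) := by
      rw [hcast, hmain, h1]
      push_cast
      ring
    exact_mod_cast this
  · intro x
    have h1 := topInd_add_one hP0 (show P < n + 1 by omega) (P * (x + m) + b : ZMod (n + 1))
    have e0 : (P * (x + e * P + m) + b : ZMod (n + 1)) = P * (x + m) + b + 1 := by
      linear_combination hPd
    have e1 : (P * (x + m) + b : ZMod (n + 1)) = -P - 1 ↔ x = a := by
      constructor
      · intro h2
        linear_combination (e * P : ZMod (n + 1)) * (h2 - ha) - (x - a) * hPd
      · rintro rfl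
        linear_combination ha
    have e2 : (P * (x + m) + b : ZMod (n + 1)) = -1 ↔ x = a + 1 := by
      constructor
      · intro h2
        linear_combination (e * P : ZMod (n + 1)) * (h2 - ha) - (x - a - 1) * hPd
      · rintro rfl
        linear_combination ha
    simp only [e0, h1, e1, e2]
  · have hbij : Function.Bijective fun x : ZMod (n + 1) => (P * (x + m) + b : ZMod (n + 1)) := by
      apply Function.Injective.bijective_of_finite
      intro x y hxy
      have hxy' : (P * (x + m) + b : ZMod (n + 1)) = P * (y + m) + b := hxy
      linear_combination (e * P : ZMod (n + 1)) * hxy' - (x - y) * hPd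
    rw [hbij.sum_comp (topInd n P), sum_topInd (by omega)]
  · intro x
    have h1 := topInd_add_one hP0 (show P < n + 1 by omega) (x - 1)
    have e1 : x - 1 = -P - 1 ↔ x = -P := by
      constructor <;> intro e <;> linear_combination e
    have e2 : x - 1 = -1 ↔ x = 0 := by
      constructor <;> intro e <;> linear_combination e
    rw [sub_add_cancel] at h1
    simp only [e1, e2] at h1
    rcases ha2 with ⟨rfl, ha2⟩ | ⟨rfl, ha2⟩
    · rw [ha2]
      simp only [Int.cast_one, one_mul, neg_add_cancel]
      linear_combination (-P : ℚ) * h1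
    · rw [ha2]
      simp only [Int.cast_neg, Int.cast_one, neg_mul, one_mul, zero_add]
      linear_combination (P : ℚ) * h1
  · rw [← Finset.mul_sum, Finset.sum_sub_distrib, ← Finset.mul_sum, sum_topInd (by omega),
      Finset.sum_const, Finset.card_univ, ZMod.card, nsmul_eq_mul, hn]
    have h1 : (P : ℚ) ^ 2 - 2 * Q ^ 2 = e := by exact_mod_cast h
    push_cast
    linear_combination (e : ℚ) * h1 + hee

end HankelTau

theorem mainTheorem4 (k : ℕ) (hk : 1 ≤ k) :
    Even (HankelTau.f (2 * k + 1)) ∧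
      HankelTau.H (HankelTau.f (2 * k + 1) / 2 + 1) (HankelTau.f (2 * k + 3) - 1) =
        (-1) ^ (k + 1) * ((HankelTau.f (2 * k + 1) / 2 : ℕ) : ℤ) := by
  obtain ⟨hq, hp⟩ := HankelTau.pell_pos k
  have h3 : HankelTau.f (2 * k + 3) = 2 * (HankelTau.pell (k + 1)).1 := HankelTau.f_odd (k + 1)
  have hnorm := HankelTau.pell_norm (k + 1)
  rw [HankelTau.f_odd, h3, Nat.mul_div_cancel_left _ two_pos]
  refine ⟨even_two_mul _, ?_⟩
  have e1 : (HankelTau.pell (k + 1)).1 = (HankelTau.pell k).1 + (HankelTau.pell k).2 := rfl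
  have e2 : (HankelTau.pell (k + 1)).2 = 2 * (HankelTau.pell k).1 + (HankelTau.pell k).2 := rfl
  -- Here e = (−1)^(k+2) and Q − P = −f_{2k+1}/2, which together give the sign (−1)^(k+1).
  rw [HankelTau.H_convergent (neg_one_pow_eq_or ℤ (k + 1 + 1)) hnorm (by omega) (by omega)
    (by omega) (by omega) (by omega), e1, e2]
  push_cast
  ring
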